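/- Let $d_A,d_B\in\mathbb N$, $n=d_Ad_B$, let $t\mapsto\rho(t)$ be a family of $n\times n$ matrices on $\mathbb C^{d_A}\otimes\mathbb C^{d_B}$ that are density matrices (positive semidefinite, unit trace) for all $t$ near $t_0\in\mathbb R$. Let $\rho^{T_B}$ be the partial transpose on the second factor, $\|X\|_1=\operatorname{Tr}\sqrt{X^\dagger X}$ the trace norm, and $\mathcal N(\rho)=\frac12(\|\rho^{T_B}\|_1-1)$ the negativity. Let $\operatorname{vec}$ stack the columns of a matrix, $\operatorname{vec}^T X=(\operatorname{vec}X)^T$, let $J^{ij}_m$ be the $m\times m$ matrix with a single entry $1$ in position $(i,j)$, and put $$K=\sum_{i,j=1}^{n}J_n^{ji}\otimes J_n^{ij},\qquad K_B=\sum_{i,j=1}^{d_B}(\mathbb 1_{d_A}\otimes J_{d_B}^{ji})\otimes(\mathbb 1_{d_A}\otimes J_{d_B}^{ij}),\qquad X_\oplus=X^T\otimes\mathbb 1+\mathbb 1\otimes X .$$ For a function $g$ of a complex $n\times n$ matrix $X$ let $D_Xg=\partial g/\partial\operatorname{vec}^TX$ and $D_{X^*}g=\partial g/\partial\operatorname{vec}^TX^*$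 be the Wirtinger derivatives with respect to the independent complex entries of $X$ (applied componentwise when $g$ is vector valued), and define the patterned Hessian of a scalar $g$ at a Hermitian matrix $A$ by $$\mathscr H_{A,A}(g)=\Big[D_X(D_Xg)^T+K\,D_X(D_{X^*}g)^T+D_{X^*}(D_Xg)^T\,K+K\,D_{X^*}(D_{X^*}g)^T\,K\Big]_{X=A}.$$ Suppose that $\rho^{T_B}(t_0)$ is invertible, and let $\rho^{T_B}(t_0)=U\Lambda U^\dagger$ be any eigendecomposition, with $U$ unitary and $\Lambda$ real diagonal. Write $U^*$ for the entrywise complex conjugate of $U$. Then the trace norm is twice continuously differentiable, as a function of the real and imaginary parts of the matrix entries, at $\rho^{T_B}(t_0)$. Its patterned Hessian $\mathscr H:=\mathscr H_{\rho^{T_B},\rho^{T_B}}(\|\cdot\|_1)$ at $\rho^{T_B}(t_0)$ is $$\mathscr H=K(U^*\otimes U)\big[\mathbb 1-\operatorname{sign}\Lambda\otimes\operatorname{sign}\Lambda\big](|\Lambda|_\oplus)^{-1}(U^T\otimes U^\dagger).$$ Moreover: (1) If $\rho$ is differentiable at $t_0$, then so is $t\mapsto\mathcal N(\rho(t))$,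 and $$\frac{d\mathcal N}{dt}\Big|_{t_0}=\frac12\operatorname{vec}^T\big[U^*\operatorname{sign}(\Lambda)U^T\big]\,K_B\operatorname{vec}\dot\rho(t_0).$$ (2) If $\rho$ is differentiable near $t_0$ and $\dot\rho$ is differentiable at $t_0$, then $\mathcal N(\rho(t))$ is differentiable near $t_0$ and twice differentiable at $t_0$, and $$\frac{d^2\mathcal N}{dt^2}\Big|_{t_0}=\frac12\big[K_B\operatorname{vec}\dot\rho(t_0)\big]^T\mathscr H\,\big[K_B\operatorname{vec}\dot\rho(t_0)\big]+\frac12\operatorname{vec}^T\big[U^*\operatorname{sign}(\Lambda)U^T\big]\,K_B\operatorname{vec}\ddot\rho(t_0).$$ -/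

import Mathlib

open scoped Matrix Kronecker Topology ComplexOrder MatrixOrder
open Filter

noncomputable section

namespace Negativity

variable {ι κ : Type*} [Fintype ι] [DecidableEq ι]

/-- A density matrix: positive semidefinite (in particular Hermitian) with unit trace. -/
def IsDensityMatrix (ρ : Matrix ι ι ℂ) : Prop :=
  ρ.PosSemidef ∧ ρ.trace = 1

/-- The trace norm `‖X‖₁ = Tr √(X† X)`; `CFC.abs X` is `√(X† X)`. -/
def traceNorm (X : Matrix ι ι ℂ) : ℝ :=
  (CFC.abs X).trace.re

/-- The partial transpose on the second tensor factor. -/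
def partialTranspose {dA dB : ℕ} (ρ : Matrix (Fin dA × Fin dB) (Fin dA × Fin dB) ℂ) :
    Matrix (Fin dA × Fin dB) (Fin dA × Fin dB) ℂ :=
  Matrix.of fun x y => ρ (x.1, y.2) (y.1, x.2)

/-- The negativity `(‖ρ^{T_B}‖₁ - 1) / 2`. -/
def negativity {dA dB : ℕ} (ρ : Matrix (Fin dA × Fin dB) (Fin dA × Fin dB) ℂ) : ℝ :=
  (traceNorm (partialTranspose ρ) - 1) / 2

/-- Entrywise complex conjugate `U*` of a matrix (no transposition). -/
def entryConj (U : Matrix ι ι ℂ) : Matrix ι ι ℂ :=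
  U.map (starRingEnd ℂ)

/- Vectorization is `Matrix.vec`: the entry `X i j` of a matrix is the component `(j, i)` of
`vec X`, so that columns are stacked and `vec (A B C) = (Cᵀ ⊗ A) vec B`. -/

variable (ι) in
/-- The commutation matrix `K = ∑ i j, J^{ji} ⊗ J^{ij}`. -/
def commutationMatrix : Matrix (ι × ι) (ι × ι) ℂ :=
  ∑ i : ι, ∑ j : ι, Matrix.single j i (1 : ℂ) ⊗ₖ Matrix.single i j (1 : ℂ)

/-- The partial commutation matrix `K_B = ∑ i j, (1 ⊗ J^{ji}) ⊗ (1 ⊗ J^{ij})`. -/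
def partialCommutationMatrix (dA dB : ℕ) :
    Matrix ((Fin dA × Fin dB) × (Fin dA × Fin dB)) ((Fin dA × Fin dB) × (Fin dA × Fin dB)) ℂ :=
  ∑ i : Fin dB, ∑ j : Fin dB,
    ((1 : Matrix (Fin dA) (Fin dA) ℂ) ⊗ₖ Matrix.single j i (1 : ℂ)) ⊗ₖ
      ((1 : Matrix (Fin dA) (Fin dA) ℂ) ⊗ₖ Matrix.single i j (1 : ℂ))

/-- `X_⊕ = Xᵀ ⊗ 1 + 1 ⊗ X`. -/
def kronPlus (X : Matrix ι ι ℂ) : Matrix (ι × ι) (ι × ι) ℂ :=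
  Xᵀ ⊗ₖ (1 : Matrix ι ι ℂ) + (1 : Matrix ι ι ℂ) ⊗ₖ X

/-- The unpatterned derivative `D_X f = ∂ f / ∂ vecᵀ X` of a vector-valued function of a matrix `X`
with independent complex entries: the row index is a component of `f`, and the column `(j, i)` holds
the Wirtinger derivative `∂/∂X_{ij} = (∂/∂(Re X_{ij}) - I ∂/∂(Im X_{ij})) / 2`. -/
def jacX (f : Matrix ι ι ℂ → κ → ℂ) (X : Matrix ι ι ℂ) : Matrix κ (ι × ι) ℂ :=
  Matrix.of fun k p =>
    (lineDeriv ℝ (fun Y => f Y k) X (Matrix.single p.2 p.1 1)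
      - Complex.I * lineDeriv ℝ (fun Y => f Y k) X (Matrix.single p.2 p.1 Complex.I)) / 2

/-- The unpatterned derivative `D_{X*} f = ∂ f / ∂ vecᵀ X*`, with the conjugate Wirtinger derivative
`∂/∂X_{ij}* = (∂/∂(Re X_{ij}) + I ∂/∂(Im X_{ij})) / 2` in column `(j, i)`. -/
def jacConjX (f : Matrix ι ι ℂ → κ → ℂ) (X : Matrix ι ι ℂ) : Matrix κ (ι × ι) ℂ :=
  Matrix.of fun k p =>
    (lineDeriv ℝ (fun Y => f Y k) X (Matrix.single p.2 p.1 1)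
      + Complex.I * lineDeriv ℝ (fun Y => f Y k) X (Matrix.single p.2 p.1 Complex.I)) / 2

/-- `(D_X g)ᵀ` for a scalar function `g`, as a vector. -/
def gradX (g : Matrix ι ι ℂ → ℂ) (X : Matrix ι ι ℂ) : ι × ι → ℂ :=
  jacX (fun Y (_ : Unit) => g Y) X ()

/-- `(D_{X*} g)ᵀ` for a scalar function `g`, as a vector. -/
def gradConjX (g : Matrix ι ι ℂ → ℂ) (X : Matrix ι ι ℂ) : ι × ι → ℂ :=
  jacConjX (fun Y (_ : Unit) => g Y) X ()

/-- The patterned Hessian `𝓗_{A,A}(g)` with respect to a Hermitian matrix `A`, built from the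
unpatterned Hessians `D_Y (D_Z g)ᵀ`, with `Y, Z ∈ {X, X*}`, evaluated at `X = A`:
`D_X(D_X g)ᵀ + K D_X(D_{X*} g)ᵀ + D_{X*}(D_X g)ᵀ K + K D_{X*}(D_{X*} g)ᵀ K`. -/
def patternedHessian (g : Matrix ι ι ℂ → ℂ) (A : Matrix ι ι ℂ) : Matrix (ι × ι) (ι × ι) ℂ :=
  jacX (gradX g) A
    + commutationMatrix ι * jacX (gradConjX g) A
    + jacConjX (gradX g) A * commutationMatrix ι
    + commutationMatrix ι * jacConjX (gradConjX g) A * commutationMatrix ι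

/-- The patterned Hessian of the trace norm. -/
def traceNormHessian (A : Matrix ι ι ℂ) : Matrix (ι × ι) (ι × ι) ℂ :=
  patternedHessian (fun X => (traceNorm X : ℂ)) A

/-- `diag Λ` as a complex matrix. -/
def realDiag (Λ : ι → ℝ) : Matrix ι ι ℂ :=
  Matrix.diagonal fun i => (Λ i : ℂ)

end Negativity

end

namespace Negativity
open scoped Matrix.Norms.L2Operator

/-! ### Eigendecompositions and smoothness of the absolute value. -/

variable {ι : Type*} [Fintype ι] [DecidableEq ι]

/-! Near an invertible Hermitian `A = U Λ U†`, `|X|` is a smooth local inverse of squaring applied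
to `X† X`: the derivative of squaring at `|A|`, `H ↦ |A| H + H |A|`, multiplies entries in the
eigenbasis by `|λᵢ| + |λⱼ| > 0` (`contDiffAt_abs`).

For Hermitian `H`, differentiating `|A + tH|² = (A + tH)²` twice gives Sylvester equations for the
derivatives of `|·|` (`sylvester_fderiv_abs`). With `h = U† H U`, solving them entrywise and taking
traces gives `∑ sign λᵢ hᵢᵢ` and, after symmetrizing in `i, j`, `∑ (1 - sign λᵢ sign λⱼ) / (|λᵢ| +
|λⱼ|) hᵢⱼ hⱼᵢ`. The latter is the quadratic form of `hessianMatrix`.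

The patterned Hessian is the matrix of the complex bilinear extension of the second derivative from
Hermitian directions (`patternedHessian_apply`), so it equals `hessianMatrix`. The negativity
formulas follow by the chain rule, since `K_B` implements the partial transpose and the curve's
derivatives stay Hermitian. -/

theorem conjTranspose_mul_self_of_mem_unitaryGroup {U : Matrix ι ι ℂ}
    (hU : U ∈ Matrix.unitaryGroup ι ℂ) : Uᴴ * U = 1 :=
  Matrix.mem_unitaryGroup_iff'.1 hU

theorem mul_conjTranspose_self_of_mem_unitaryGroup {U : Matrix ι ι ℂ}
    (hU : U ∈ Matrix.unitaryGroup ι ℂ) : U * Uᴴ = 1 :=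
  Matrix.mem_unitaryGroup_iff.1 hU

theorem eigendecomposition_mul {U : Matrix ι ι ℂ} (hU : U ∈ Matrix.unitaryGroup ι ℂ)
    (D E : Matrix ι ι ℂ) : U * D * Uᴴ * (U * E * Uᴴ) = U * (D * E) * Uᴴ := by
  have h := conjTranspose_mul_self_of_mem_unitaryGroup hU
  calc U * D * Uᴴ * (U * E * Uᴴ) = U * D * (Uᴴ * U) * (E * Uᴴ) := by noncomm_ring
    _ = _ := by rw [h]; noncomm_ring

theorem eigendecomposition_nonneg (U : Matrix ι ι ℂ) {d : ι → ℝ} (hd : ∀ i, 0 ≤ d i) :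
    0 ≤ U * realDiag d * Uᴴ := by
  rw [Matrix.nonneg_iff_posSemidef]
  refine Matrix.PosSemidef.mul_mul_conjTranspose_same ?_ U
  exact Matrix.PosSemidef.diagonal fun i => by simpa using hd i

theorem conjTranspose_eigendecomposition (U : Matrix ι ι ℂ) (d : ι → ℝ) :
    (U * realDiag d * Uᴴ)ᴴ = U * realDiag d * Uᴴ := by
  have : (realDiag d)ᴴ = realDiag d := by
    rw [realDiag, Matrix.diagonal_conjTranspose]; congr 1; ext i; simp
  simp [Matrix.conjTranspose_mul, this, Matrix.mul_assoc]

theorem abs_eigendecomposition {U : Matrix ι ι ℂ} (hU : U ∈ Matrix.unitaryGroup ι ℂ)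
    (d : ι → ℝ) :
    CFC.abs (U * realDiag d * Uᴴ) = U * realDiag (fun i => |d i|) * Uᴴ := by
  refine CFC.sqrt_unique ?_ (eigendecomposition_nonneg U fun i => abs_nonneg _)
  rw [Matrix.star_eq_conjTranspose, conjTranspose_eigendecomposition,
    eigendecomposition_mul hU, eigendecomposition_mul hU]
  simp only [realDiag, Matrix.diagonal_mul_diagonal]
  congr 3
  ext i
  exact_mod_cast abs_mul_abs_self (d i)

theorem continuous_abs : Continuous (CFC.abs : Matrix ι ι ℂ → Matrix ι ι ℂ) := by
  have h : (CFC.abs : Matrix ι ι ℂ → Matrix ι ι ℂ)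
      = fun X => cfc NNReal.sqrt (star X * X) := by
    ext1 X; rw [CFC.abs, CFC.sqrt_eq_cfc]
  rw [h, ← continuousOn_univ]
  refine ContinuousOn.cfc_nnreal_of_mem_nhdsSet (s := Set.univ) _ Filter.univ_mem (by fun_prop)
    fun x _ => star_mul_self_nonneg x

/-- The Sylvester operator `H ↦ P H + H P`. -/
noncomputable def sylvester (P : Matrix ι ι ℂ) : Matrix ι ι ℂ →L[ℝ] Matrix ι ι ℂ :=
  ContinuousLinearMap.mul ℝ _ P + (ContinuousLinearMap.mul ℝ _).flip P

theorem sylvester_apply (P H : Matrix ι ι ℂ) : sylvester P H = P * H + H * P := rfl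

theorem conj_sylvester {U : Matrix ι ι ℂ} (hU : U ∈ Matrix.unitaryGroup ι ℂ) (d : ι → ℝ)
    (H : Matrix ι ι ℂ) (i j : ι) :
    (Uᴴ * sylvester (U * realDiag d * Uᴴ) H * U) i j = (d i + d j) * (Uᴴ * H * U) i j := by
  have h := conjTranspose_mul_self_of_mem_unitaryGroup hU
  have : Uᴴ * sylvester (U * realDiag d * Uᴴ) H * U
      = realDiag d * (Uᴴ * H * U) + (Uᴴ * H * U) * realDiag d := by
    calc _ = (Uᴴ * U) * realDiag d * (Uᴴ * H * U) + (Uᴴ * H * U) * realDiag d * (Uᴴ * U) := by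
          rw [sylvester_apply]; noncomm_ring
      _ = _ := by rw [h]; noncomm_ring
  rw [this, Matrix.add_apply, realDiag, Matrix.diagonal_mul, Matrix.mul_diagonal]
  ring

theorem unitary_conj_injective {U : Matrix ι ι ℂ} (hU : U ∈ Matrix.unitaryGroup ι ℂ)
    {X Y : Matrix ι ι ℂ} (h : Uᴴ * X * U = Uᴴ * Y * U) : X = Y := by
  have h' := mul_conjTranspose_self_of_mem_unitaryGroup hU
  calc X = (U * Uᴴ) * X * (U * Uᴴ) := by rw [h']; simp
    _ = U * (Uᴴ * X * U) * Uᴴ := by noncomm_ring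
    _ = (U * Uᴴ) * Y * (U * Uᴴ) := by rw [h]; noncomm_ring
    _ = Y := by rw [h']; simp

theorem sylvester_injective {U : Matrix ι ι ℂ} (hU : U ∈ Matrix.unitaryGroup ι ℂ) {d : ι → ℝ}
    (hd : ∀ i, 0 < d i) : Function.Injective (sylvester (U * realDiag d * Uᴴ)) := by
  intro X Y hXY
  refine unitary_conj_injective hU ?_
  ext i j
  have h : (d i + d j : ℂ) ≠ 0 := by
    exact_mod_cast (add_pos (hd i) (hd j)).ne'
  apply mul_left_cancel₀ h
  rw [← conj_sylvester hU, ← conj_sylvester hU, hXY]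

theorem contDiffAt_abs {U : Matrix ι ι ℂ} (hU : U ∈ Matrix.unitaryGroup ι ℂ) {d : ι → ℝ}
    (hd : ∀ i, d i ≠ 0) (n : ℕ∞) :
    ContDiffAt ℝ n (CFC.abs : Matrix ι ι ℂ → Matrix ι ι ℂ) (U * realDiag d * Uᴴ) := by
  -- The inverse function theorem needs at least one derivative, so the case `n = 0` is absorbed
  -- here.
  suffices h : ContDiffAt ℝ (max n 1 : ℕ∞) (CFC.abs : Matrix ι ι ℂ → Matrix ι ι ℂ)
      (U * realDiag d * Uᴴ) from h.of_le (by exact_mod_cast le_max_left _ _)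
  set m : ℕ∞ := max n 1
  set A := U * realDiag d * Uᴴ
  set P := U * realDiag (fun i => |d i|) * Uᴴ with hP
  have hinj : Function.Injective (sylvester P) := sylvester_injective hU fun i => abs_pos.2 (hd i)
  let e : Matrix ι ι ℂ ≃L[ℝ] Matrix ι ι ℂ :=
    (LinearEquiv.ofInjectiveEndo (sylvester P).toLinearMap hinj).toContinuousLinearEquiv
  have he : (e : Matrix ι ι ℂ →L[ℝ] Matrix ι ι ℂ) = sylvester P := by ext1 X; rfl
  let sq : Matrix ι ι ℂ → Matrix ι ι ℂ := fun X => X * X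
  have hsq : ContDiffAt ℝ m sq P := by fun_prop
  have hsq' : HasFDerivAt sq (e : Matrix ι ι ℂ →L[ℝ] Matrix ι ι ℂ) P := by
    rw [he]
    have := (hasFDerivAt_id (𝕜 := ℝ) P).mul' (hasFDerivAt_id P)
    refine this.congr_fderiv ?_
    ext1 X
    simp [sylvester_apply]
  have hm : (m : WithTop ℕ∞) ≠ 0 := by
    have : (1 : ℕ∞) ≤ m := le_max_right _ _
    have : m ≠ 0 := by intro h; rw [h] at this; simp at this
    exact_mod_cast this
  have hg := hsq.to_localInverse hsq' hm
  have hstrict : HasStrictFDerivAt sq (e : Matrix ι ι ℂ →L[ℝ] Matrix ι ι ℂ) P :=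
    hsq.hasStrictFDerivAt' hsq' hm
  have hleft := hstrict.eventually_left_inverse
  have habs : CFC.abs A = P := abs_eigendecomposition hU d
  -- Continuity selects the branch: `|X|` stays near `P`, where the local inverse undoes squaring.
  have htend : Tendsto (CFC.abs : Matrix ι ι ℂ → Matrix ι ι ℂ) (𝓝 A) (𝓝 P) := by
    rw [← habs]; exact continuous_abs.continuousAt
  have hev := htend.eventually hleft
  have hAA : star A * A = sq P := by
    rw [← habs]; exact (CFC.abs_mul_abs A).symm
  have hstar : ContDiffAt ℝ m (fun X : Matrix ι ι ℂ => star X * X) A :=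
    ((starL' ℝ : Matrix ι ι ℂ ≃L[ℝ] Matrix ι ι ℂ).contDiff.contDiffAt).mul contDiffAt_id
  have hcomp := ContDiffAt.comp (g := hsq.localInverse hsq' hm) A (by rw [hAA]; exact hg) hstar
  refine hcomp.congr_of_eventuallyEq ?_
  filter_upwards [hev] with X hX
  rw [Function.comp_apply, ← CFC.abs_mul_abs X]
  exact hX.symm

/-! ### Second-order chain rule along a curve. -/

section Calculus

variable {E F : Type*} [NormedAddCommGroup E] [NormedSpace ℝ E] [NormedAddCommGroup F]
  [NormedSpace ℝ F] {G : E → F} {γ γ' : ℝ → E} {γ₂ : E} {t₀ : ℝ}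

theorem eventually_hasDerivAt_comp (hG : ContDiffAt ℝ 2 G (γ t₀))
    (hγ : ∀ᶠ t in 𝓝 t₀, HasDerivAt γ (γ' t) t) :
    ∀ᶠ t in 𝓝 t₀, HasDerivAt (fun t => G (γ t)) (fderiv ℝ G (γ t) (γ' t)) t := by
  have h1 := hγ.self_of_nhds.continuousAt.eventually (hG.eventually (by simp))
  filter_upwards [h1, hγ] with t ht ht'
  exact (ht.differentiableAt (by simp)).hasFDerivAt.comp_hasDerivAt t ht'

theorem hasDerivAt_fderiv_comp (hG : ContDiffAt ℝ 2 G (γ t₀))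
    (hγ : HasDerivAt γ (γ' t₀) t₀) (hγ' : HasDerivAt γ' γ₂ t₀) :
    HasDerivAt (fun t => fderiv ℝ G (γ t) (γ' t))
      (fderiv ℝ (fderiv ℝ G) (γ t₀) (γ' t₀) (γ' t₀) + fderiv ℝ G (γ t₀) γ₂) t₀ := by
  have h1 : ContDiffAt ℝ 1 (fderiv ℝ G) (γ t₀) := hG.fderiv_right (by norm_num)
  have h2 := (h1.differentiableAt (by simp)).hasFDerivAt.comp_hasDerivAt t₀ hγ
  exact h2.clm_apply hγ'

theorem hasDerivAt_line (a h : E) (t : ℝ) : HasDerivAt (fun t : ℝ => a + t • h) h t := by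
  simpa using ((hasDerivAt_id t).smul_const h).const_add a

end Calculus

/-! ### Derivatives of the absolute value and of the trace norm in Hermitian directions. -/

variable {U : Matrix ι ι ℂ} {d : ι → ℝ}

/-- These are the first and second derivatives at `t = 0` of `|A + tH|² = (A + tH)²`. Hermiticity of
`H` is what turns `(A + tH)† (A + tH)` into a square. -/
theorem sylvester_fderiv_abs (hU : U ∈ Matrix.unitaryGroup ι ℂ) (hd : ∀ i, d i ≠ 0)
    {H : Matrix ι ι ℂ} (hH : H.IsHermitian) :
    sylvester (U * realDiag (fun i => |d i|) * Uᴴ)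
        (fderiv ℝ CFC.abs (U * realDiag d * Uᴴ) H) =
      sylvester (U * realDiag d * Uᴴ) H ∧
    sylvester (U * realDiag (fun i => |d i|) * Uᴴ)
        (fderiv ℝ (fderiv ℝ CFC.abs) (U * realDiag d * Uᴴ) H H) =
      2 * (H * H) - 2 * (fderiv ℝ CFC.abs (U * realDiag d * Uᴴ) H *
        fderiv ℝ CFC.abs (U * realDiag d * Uᴴ) H) := by
  rw [← abs_eigendecomposition hU]
  have hA : (U * realDiag d * Uᴴ)ᴴ = _ := conjTranspose_eigendecomposition U d
  have hC : ContDiffAt ℝ 2 (CFC.abs : Matrix ι ι ℂ → Matrix ι ι ℂ) (U * realDiag d * Uᴴ) :=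
    contDiffAt_abs hU hd 2
  set A := U * realDiag d * Uᴴ
  have hsq : ∀ t : ℝ, CFC.abs (A + t • H) * CFC.abs (A + t • H) = (A + t • H) * (A + t • H) := by
    intro t
    rw [CFC.abs_mul_abs, Matrix.star_eq_conjTranspose, Matrix.conjTranspose_add,
      Matrix.conjTranspose_smul, hA, hH.eq]
    simp
  have hl := hasDerivAt_line A H
  have hA0 : A + (0 : ℝ) • H = A := by simp
  have h1 := eventually_hasDerivAt_comp (G := CFC.abs) (γ := fun t : ℝ => A + t • H)
    (γ' := fun _ => H) (t₀ := 0) (by rw [hA0]; exact hC) (Eventually.of_forall hl)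
  have h2 := hasDerivAt_fderiv_comp (G := CFC.abs) (γ := fun t : ℝ => A + t • H)
    (γ' := fun _ => H) (t₀ := 0) (by rw [hA0]; exact hC) (hl 0) (hasDerivAt_const _ _)
  -- The first-order identity is kept on a neighbourhood so that it can be differentiated once more.
  have h3 : ∀ᶠ t in 𝓝 (0 : ℝ),
      fderiv ℝ CFC.abs (A + t • H) H * CFC.abs (A + t • H)
        + CFC.abs (A + t • H) * fderiv ℝ CFC.abs (A + t • H) H
      = H * (A + t • H) + (A + t • H) * H := by
    filter_upwards [h1] with t ht
    have h4 := ht.mul ht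
    have h5 := (hl t).mul (hl t)
    refine h4.unique (h5.congr_of_eventuallyEq (Eventually.of_forall fun t => ?_))
    exact hsq t
  constructor
  · have := h3.self_of_nhds
    simp only [hA0] at this
    rw [sylvester_apply, sylvester_apply, add_comm, this, add_comm]
  · have h0 := h1.self_of_nhds
    have h4 := (h2.mul h0).add (h0.mul h2)
    have h5 := ((hl 0).const_mul H).add ((hl 0).mul_const H)
    have h6 := h4.unique (h5.congr_of_eventuallyEq h3)
    simp only [hA0, map_zero, add_zero] at h6
    rw [sylvester_apply, eq_sub_iff_add_eq, two_mul, two_mul, ← h6]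
    abel

/-- The real part of the trace as a continuous real-linear functional. -/
noncomputable def traceRe : Matrix ι ι ℂ →L[ℝ] ℝ :=
  (Complex.reLm ∘ₗ Matrix.traceLinearMap ι ℝ ℂ).toContinuousLinearMap

omit [DecidableEq ι] in
theorem traceRe_apply (X : Matrix ι ι ℂ) : traceRe X = X.trace.re := rfl

theorem contDiffAt_traceNorm (hU : U ∈ Matrix.unitaryGroup ι ℂ) (hd : ∀ i, d i ≠ 0) (n : ℕ∞) :
    ContDiffAt ℝ n (traceNorm : Matrix ι ι ℂ → ℝ) (U * realDiag d * Uᴴ) :=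
  (traceRe (ι := ι)).contDiff.contDiffAt.comp _ (contDiffAt_abs hU hd n)

theorem fderiv_traceNorm (hU : U ∈ Matrix.unitaryGroup ι ℂ) (hd : ∀ i, d i ≠ 0) :
    ∀ᶠ X in 𝓝 (U * realDiag d * Uᴴ), fderiv ℝ traceNorm X = traceRe.comp (fderiv ℝ CFC.abs X) := by
  have h : ∀ᶠ X in 𝓝 (U * realDiag d * Uᴴ), ContDiffAt ℝ 1 (CFC.abs : Matrix ι ι ℂ → _) X :=
    (contDiffAt_abs hU hd 1).eventually (by simp)
  filter_upwards [h] with X hX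
  exact (traceRe.hasFDerivAt.comp X (hX.differentiableAt (by simp)).hasFDerivAt).fderiv

theorem fderiv_fderiv_traceNorm (hU : U ∈ Matrix.unitaryGroup ι ℂ) (hd : ∀ i, d i ≠ 0)
    (H K : Matrix ι ι ℂ) :
    fderiv ℝ (fderiv ℝ traceNorm) (U * realDiag d * Uᴴ) H K
      = traceRe (fderiv ℝ (fderiv ℝ CFC.abs) (U * realDiag d * Uᴴ) H K) := by
  have hC : ContDiffAt ℝ 1 (fderiv ℝ (CFC.abs : Matrix ι ι ℂ → Matrix ι ι ℂ))
      (U * realDiag d * Uᴴ) := (contDiffAt_abs hU hd 2).fderiv_right (by norm_num)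
  have h1 := (hC.differentiableAt (by simp)).hasFDerivAt
  have h2 := ((ContinuousLinearMap.compL ℝ (Matrix ι ι ℂ) (Matrix ι ι ℂ) ℝ
    traceRe).hasFDerivAt.comp (U * realDiag d * Uᴴ) h1)
  rw [Filter.EventuallyEq.fderiv_eq (fderiv_traceNorm hU hd)]
  have h3 := h2.fderiv
  rw [Function.comp_def] at h3
  exact congr($h3 H K)

theorem trace_unitary_conj (hU : U ∈ Matrix.unitaryGroup ι ℂ) (X : Matrix ι ι ℂ) :
    X.trace = ∑ i, (Uᴴ * X * U) i i := by
  change _ = Matrix.trace _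
  rw [Matrix.trace_mul_cycle, mul_conjTranspose_self_of_mem_unitaryGroup hU, one_mul]

theorem unitary_conj_mul (hU : U ∈ Matrix.unitaryGroup ι ℂ) (X Y : Matrix ι ι ℂ) :
    Uᴴ * (X * Y) * U = (Uᴴ * X * U) * (Uᴴ * Y * U) := by
  have h := mul_conjTranspose_self_of_mem_unitaryGroup hU
  calc _ = Uᴴ * X * (1 * (Y * U)) := by noncomm_ring
    _ = _ := by rw [← h]; noncomm_ring

omit [DecidableEq ι] in
theorem isHermitian_unitary_conj {H : Matrix ι ι ℂ} (hH : H.IsHermitian) (U : Matrix ι ι ℂ) :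
    (Uᴴ * H * U).IsHermitian :=
  Matrix.isHermitian_conjTranspose_mul_mul U hH

theorem unitary_conj_fderiv_abs (hU : U ∈ Matrix.unitaryGroup ι ℂ) (hd : ∀ i, d i ≠ 0)
    {H : Matrix ι ι ℂ} (hH : H.IsHermitian) (i j : ι) :
    (Uᴴ * fderiv ℝ CFC.abs (U * realDiag d * Uᴴ) H * U) i j =
      ((d i + d j) / (|d i| + |d j|) : ℝ) * (Uᴴ * H * U) i j := by
  have h0 : ((|d i| + |d j| : ℝ) : ℂ) ≠ 0 := by
    exact_mod_cast (add_pos (abs_pos.2 (hd i)) (abs_pos.2 (hd j))).ne'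
  have h := congr((Uᴴ * $((sylvester_fderiv_abs hU hd hH).1) * U) i j)
  rw [conj_sylvester hU, conj_sylvester hU] at h
  push_cast at h h0 ⊢
  field_simp
  linear_combination h

theorem sign_eq_div_abs {x : ℝ} (hx : x ≠ 0) : x.sign = x / |x| := by
  rcases hx.lt_or_gt with h | h
  · rw [Real.sign_of_neg h, abs_of_neg h, div_neg, div_self hx]
  · rw [Real.sign_of_pos h, abs_of_pos h, div_self hx]

theorem trace_fderiv_abs (hU : U ∈ Matrix.unitaryGroup ι ℂ) (hd : ∀ i, d i ≠ 0)
    {H : Matrix ι ι ℂ} (hH : H.IsHermitian) :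
    (fderiv ℝ CFC.abs (U * realDiag d * Uᴴ) H).trace =
      ∑ i, ((d i).sign : ℂ) * (Uᴴ * H * U) i i := by
  rw [trace_unitary_conj hU]
  refine Finset.sum_congr rfl fun i _ => ?_
  rw [unitary_conj_fderiv_abs hU hd hH, sign_eq_div_abs (hd i)]
  congr 2
  have := abs_pos.2 (hd i)
  field_simp

/-- With `s = |x| + |y|`, the left side is `(s² - (x + y)²) / (s |x| |y|)`, and the squares cancel
to leave `2 (|x| |y| - x y)` in the numerator. -/
theorem symmetrized_weight {x y : ℝ} (hx : x ≠ 0) (hy : y ≠ 0) :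
    (1 - ((x + y) / (|x| + |y|)) ^ 2) / |x| + (1 - ((y + x) / (|y| + |x|)) ^ 2) / |y|
      = 2 * ((1 - x.sign * y.sign) / (|x| + |y|)) := by
  have hx' := abs_pos.2 hx
  have hy' := abs_pos.2 hy
  have hs := add_pos hx' hy'
  rw [sign_eq_div_abs hx, sign_eq_div_abs hy, add_comm |y|, add_comm y]
  field_simp
  linear_combination (|x| + |y|) * (sq_abs x + sq_abs y)

omit [DecidableEq ι] in
theorem sum_symmetrize {a b : ι → ι → ℂ} (hab : ∀ i j, a i j + a j i = 2 * b i j) :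
    ∑ i, ∑ j, a i j = ∑ i, ∑ j, b i j := by
  have h : ∑ i, ∑ j, a j i = ∑ i, ∑ j, a i j := Finset.sum_comm
  have h2 : ∑ i, ∑ j, a i j + ∑ i, ∑ j, a j i = 2 * ∑ i, ∑ j, b i j := by
    simp only [← Finset.sum_add_distrib, Finset.mul_sum, hab]
  rw [h] at h2
  linear_combination h2 / 2

/-- The trace needs only diagonal entries of the second Sylvester equation, where the operator is
multiplication by `2|λᵢ|`. The resulting weight is not symmetric in `i, j`, but the product it
multiplies is, so only its symmetrization matters. -/
theorem trace_fderiv_fderiv_abs (hU : U ∈ Matrix.unitaryGroup ι ℂ) (hd : ∀ i, d i ≠ 0)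
    {H : Matrix ι ι ℂ} (hH : H.IsHermitian) :
    (fderiv ℝ (fderiv ℝ CFC.abs) (U * realDiag d * Uᴴ) H H).trace =
      ∑ i, ∑ j, (((1 - (d i).sign * (d j).sign) / (|d i| + |d j|) : ℝ) : ℂ) *
        ((Uᴴ * H * U) i j * (Uᴴ * H * U) j i) := by
  have hii : ∀ i, (Uᴴ * fderiv ℝ (fderiv ℝ CFC.abs) (U * realDiag d * Uᴴ) H H * U) i i =
      ∑ j, (((1 - ((d i + d j) / (|d i| + |d j|)) ^ 2) / |d i| : ℝ) : ℂ) *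
        ((Uᴴ * H * U) i j * (Uᴴ * H * U) j i) := by
    intro i
    have h0 : ((|d i| : ℝ) : ℂ) ≠ 0 := by exact_mod_cast (abs_pos.2 (hd i)).ne'
    have h := congr((Uᴴ * $((sylvester_fderiv_abs hU hd hH).2) * U) i i)
    have h2 : Uᴴ * (2 * (H * H) - 2 * (fderiv ℝ CFC.abs (U * realDiag d * Uᴴ) H *
        fderiv ℝ CFC.abs (U * realDiag d * Uᴴ) H)) * U
        = (2 : ℂ) • (Uᴴ * (H * H) * U - Uᴴ * (fderiv ℝ CFC.abs (U * realDiag d * Uᴴ) H *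
        fderiv ℝ CFC.abs (U * realDiag d * Uᴴ) H) * U) := by
      rw [two_smul]; noncomm_ring
    rw [h2, conj_sylvester hU, unitary_conj_mul hU, unitary_conj_mul hU, Matrix.smul_apply,
      Matrix.sub_apply, Matrix.mul_apply (M := Uᴴ * H * U),
      Matrix.mul_apply (M := Uᴴ * fderiv ℝ CFC.abs _ H * U), ← Finset.sum_sub_distrib] at h
    have h3 : (Uᴴ * fderiv ℝ (fderiv ℝ CFC.abs) (U * realDiag d * Uᴴ) H H * U) i i
      = ((|d i| : ℝ) : ℂ)⁻¹ * ∑ j, ((Uᴴ * H * U) i j * (Uᴴ * H * U) j i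
        - (Uᴴ * fderiv ℝ CFC.abs (U * realDiag d * Uᴴ) H * U) i j *
          (Uᴴ * fderiv ℝ CFC.abs (U * realDiag d * Uᴴ) H * U) j i) := by
      rw [eq_inv_mul_iff_mul_eq₀ h0]
      rw [smul_eq_mul] at h
      linear_combination h / 2
    rw [h3, Finset.mul_sum]
    refine Finset.sum_congr rfl fun j _ => ?_
    rw [unitary_conj_fderiv_abs hU hd hH, unitary_conj_fderiv_abs hU hd hH, add_comm (d j),
      add_comm |d j|]
    push_cast
    ring
  rw [trace_unitary_conj hU, Finset.sum_congr rfl fun i _ => hii i]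
  refine sum_symmetrize fun i j => ?_
  have h := congr(($(symmetrized_weight (hd i) (hd j)) : ℂ))
  push_cast at h ⊢
  linear_combination (Uᴴ * H * U) i j * (Uᴴ * H * U) j i * h

theorem ofReal_fderiv_traceNorm (hU : U ∈ Matrix.unitaryGroup ι ℂ) (hd : ∀ i, d i ≠ 0)
    {H : Matrix ι ι ℂ} (hH : H.IsHermitian) :
    ((fderiv ℝ traceNorm (U * realDiag d * Uᴴ) H : ℝ) : ℂ) =
      ∑ i, ((d i).sign : ℂ) * (Uᴴ * H * U) i i := by
  rw [(fderiv_traceNorm hU hd).self_of_nhds, ContinuousLinearMap.comp_apply, traceRe_apply,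
    trace_fderiv_abs hU hd hH]
  refine Complex.conj_eq_iff_re.1 ?_
  rw [map_sum]
  refine Finset.sum_congr rfl fun i _ => ?_
  rw [map_mul, Complex.conj_ofReal]
  congr 1
  exact (isHermitian_unitary_conj hH U).apply i i

theorem ofReal_fderiv_fderiv_traceNorm (hU : U ∈ Matrix.unitaryGroup ι ℂ) (hd : ∀ i, d i ≠ 0)
    {H : Matrix ι ι ℂ} (hH : H.IsHermitian) :
    ((fderiv ℝ (fderiv ℝ traceNorm) (U * realDiag d * Uᴴ) H H : ℝ) : ℂ) =
      ∑ i, ∑ j, (((1 - (d i).sign * (d j).sign) / (|d i| + |d j|) : ℝ) : ℂ) *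
        ((Uᴴ * H * U) i j * (Uᴴ * H * U) j i) := by
  rw [fderiv_fderiv_traceNorm hU hd, traceRe_apply, trace_fderiv_fderiv_abs hU hd hH]
  -- The sum is real: conjugation exchanges the two factors of each Hermitian product.
  refine Complex.conj_eq_iff_re.1 ?_
  simp only [map_sum, map_mul, Complex.conj_ofReal]
  refine Finset.sum_congr rfl fun i _ => Finset.sum_congr rfl fun j _ => ?_
  congr 1
  rw [mul_comm]
  exact congrArg₂ _ ((isHermitian_unitary_conj hH U).apply i j)
    ((isHermitian_unitary_conj hH U).apply j i)

/-! ### Commutation matrices and the bilinear form of the closed-form Hessian. -/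

theorem commutationMatrix_apply (p q : ι × ι) :
    commutationMatrix ι p q = if p.swap = q then 1 else 0 := by
  obtain ⟨a, b⟩ := p
  obtain ⟨e, f⟩ := q
  simp only [commutationMatrix, Matrix.sum_apply, Matrix.kroneckerMap_apply, Matrix.single_apply,
    Prod.swap_prod_mk, Prod.mk.injEq]
  rw [Finset.sum_eq_single e, Finset.sum_eq_single f]
  · by_cases h1 : b = e <;> by_cases h2 : a = f <;> simp [h1, h2, eq_comm]
  · intro i _ hi; simp [hi]
  · simp
  · intro i _ hi; simp [hi]
  · simp

theorem commutationMatrix_mul_apply (M : Matrix (ι × ι) (ι × ι) ℂ) (p q : ι × ι) :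
    (commutationMatrix ι * M) p q = M p.swap q := by
  simp [Matrix.mul_apply, commutationMatrix_apply]

theorem mul_commutationMatrix_apply (M : Matrix (ι × ι) (ι × ι) ℂ) (p q : ι × ι) :
    (M * commutationMatrix ι) p q = M p q.swap := by
  simp [Matrix.mul_apply, commutationMatrix_apply, Prod.swap_eq_iff_eq_swap]

theorem vec_vecMul_commutationMatrix (H : Matrix ι ι ℂ) :
    Matrix.vec H ᵥ* commutationMatrix ι = Matrix.vec Hᵀ := by
  ext p
  simp [Matrix.vecMul, dotProduct, commutationMatrix_apply, Prod.swap_eq_iff_eq_swap, Matrix.vec]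

theorem partialCommutationMatrix_mulVec_vec {dA dB : ℕ}
    (X : Matrix (Fin dA × Fin dB) (Fin dA × Fin dB) ℂ) :
    partialCommutationMatrix dA dB *ᵥ Matrix.vec X = Matrix.vec (partialTranspose X) := by
  simp only [partialCommutationMatrix, Matrix.sum_mulVec, Matrix.kronecker_mulVec_vec,
    ← Matrix.vec_sum]
  congr 1
  ext ⟨a, i⟩ ⟨b, j⟩
  simp only [Matrix.sum_apply, partialTranspose, Matrix.of_apply]
  rw [Finset.sum_eq_single i, Finset.sum_eq_single j]
  · simp [Matrix.mul_apply, Fintype.sum_prod_type, Matrix.single_apply, Matrix.one_apply]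
  · intro k _ hk
    simp [Matrix.mul_apply, Matrix.single_apply, Matrix.one_apply, hk]
  · simp
  · intro k _ hk
    simp [Matrix.mul_apply, Matrix.single_apply, Matrix.one_apply, hk]
  · simp

/-- The closed form of the patterned Hessian of the trace norm at `U * realDiag d * Uᴴ`. -/
noncomputable def hessianMatrix (U : Matrix ι ι ℂ) (d : ι → ℝ) : Matrix (ι × ι) (ι × ι) ℂ :=
  commutationMatrix ι * (entryConj U ⊗ₖ U) *
    (1 - realDiag (fun i => (d i).sign) ⊗ₖ realDiag (fun i => (d i).sign)) *
    (kronPlus (realDiag fun i => |d i|))⁻¹ * (Uᵀ ⊗ₖ Uᴴ)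

theorem one_sub_sign_mul_inv_kronPlus (hd : ∀ i, d i ≠ 0) :
    (1 - realDiag (fun i => (d i).sign) ⊗ₖ realDiag (fun i => (d i).sign)) *
      (kronPlus (realDiag fun i => |d i|))⁻¹ =
    Matrix.diagonal fun p : ι × ι =>
      (((1 - (d p.1).sign * (d p.2).sign) / (|d p.1| + |d p.2|) : ℝ) : ℂ) := by
  have h0 : ∀ p : ι × ι, ((|d p.1| + |d p.2| : ℝ) : ℂ) ≠ 0 := fun p => by
    exact_mod_cast (add_pos (abs_pos.2 (hd p.1)) (abs_pos.2 (hd p.2))).ne'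
  have h1 : kronPlus (realDiag fun i => |d i|) =
      Matrix.diagonal fun p : ι × ι => ((|d p.1| + |d p.2| : ℝ) : ℂ) := by
    rw [kronPlus, realDiag, Matrix.diagonal_transpose, ← Matrix.diagonal_one,
      Matrix.diagonal_kronecker_diagonal, Matrix.diagonal_kronecker_diagonal,
      Matrix.diagonal_add]
    simp
  have h2 : (kronPlus (realDiag fun i => |d i|))⁻¹ =
      Matrix.diagonal fun p : ι × ι => ((|d p.1| + |d p.2| : ℝ) : ℂ)⁻¹ := by
    refine Matrix.inv_eq_right_inv ?_
    rw [h1, Matrix.diagonal_mul_diagonal, ← Matrix.diagonal_one]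
    congr 1
    ext p
    exact mul_inv_cancel₀ (h0 p)
  rw [h2, realDiag, Matrix.diagonal_kronecker_diagonal, ← Matrix.diagonal_one,
    Matrix.diagonal_sub, Matrix.diagonal_mul_diagonal]
  congr 1
  ext p
  push_cast
  rw [div_eq_mul_inv]

/-- The leading `commutationMatrix` replaces `H` by `Hᵀ`, and `Uᵀ Hᵀ U* = (U† H U)ᵀ`. Hence both
arguments appear in the same eigenbasis, with opposite index order. -/
theorem vec_dotProduct_hessianMatrix_mulVec (hd : ∀ i, d i ≠ 0) (H K : Matrix ι ι ℂ) :
    Matrix.vec H ⬝ᵥ (hessianMatrix U d *ᵥ Matrix.vec K) =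
      ∑ i, ∑ j, (((1 - (d i).sign * (d j).sign) / (|d i| + |d j|) : ℝ) : ℂ) *
        ((Uᴴ * H * U) i j * (Uᴴ * K * U) j i) := by
  rw [hessianMatrix, Matrix.mul_assoc (commutationMatrix ι * _), one_sub_sign_mul_inv_kronPlus hd,
    ← Matrix.mulVec_mulVec, ← Matrix.mulVec_mulVec, Matrix.kronecker_mulVec_vec,
    Matrix.dotProduct_mulVec, ← Matrix.vecMul_vecMul, vec_vecMul_commutationMatrix,
    Matrix.vec_vecMul_kronecker]
  have h : Uᵀ * Hᵀ * entryConj U = (Uᴴ * H * U)ᵀ := by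
    simp only [Matrix.transpose_mul, Matrix.mul_assoc]
    rfl
  rw [h, Matrix.transpose_transpose, dotProduct, Fintype.sum_prod_type]
  refine Finset.sum_congr rfl fun i _ => Finset.sum_congr rfl fun j _ => ?_
  rw [Matrix.mulVec_diagonal]
  simp only [Matrix.vec, Matrix.transpose_apply]
  ring

/-- For Hermitian directions the second derivative of the trace norm is the bilinear form of
`hessianMatrix`. -/
theorem ofReal_fderiv_fderiv_traceNorm_eq (hU : U ∈ Matrix.unitaryGroup ι ℂ)
    (hd : ∀ i, d i ≠ 0) {H K : Matrix ι ι ℂ} (hH : H.IsHermitian) (hK : K.IsHermitian) :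
    ((fderiv ℝ (fderiv ℝ traceNorm) (U * realDiag d * Uᴴ) H K : ℝ) : ℂ) =
      Matrix.vec H ⬝ᵥ (hessianMatrix U d *ᵥ Matrix.vec K) := by
  have hsymm := ((contDiffAt_traceNorm hU hd 2).isSymmSndFDerivAt (by simp)).eq H K
  have hdiag : ∀ {L : Matrix ι ι ℂ}, L.IsHermitian →
      ((fderiv ℝ (fderiv ℝ traceNorm) (U * realDiag d * Uᴴ) L L : ℝ) : ℂ) =
        Matrix.vec L ⬝ᵥ (hessianMatrix U d *ᵥ Matrix.vec L) := fun hL => by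
    rw [ofReal_fderiv_fderiv_traceNorm hU hd hL, vec_dotProduct_hessianMatrix_mulVec hd]
  have hflip : Matrix.vec K ⬝ᵥ (hessianMatrix U d *ᵥ Matrix.vec H) =
      Matrix.vec H ⬝ᵥ (hessianMatrix U d *ᵥ Matrix.vec K) := by
    rw [vec_dotProduct_hessianMatrix_mulVec hd, vec_dotProduct_hessianMatrix_mulVec hd,
      Finset.sum_comm]
    refine Finset.sum_congr rfl fun i _ => Finset.sum_congr rfl fun j _ => ?_
    rw [mul_comm (d j).sign, add_comm |d j|]
    ring
  -- Polarization: both bilinear forms are symmetric and agree on the diagonal.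
  have h := hdiag (hH.add hK)
  simp only [map_add, add_apply, Matrix.vec_add, Matrix.mulVec_add,
    add_dotProduct, dotProduct_add, Complex.ofReal_add, hdiag hH, hdiag hK, hflip, ← hsymm] at h
  linear_combination h / 2

/-! ### Wirtinger derivatives and the patterned Hessian. -/

theorem lineDeriv_ofReal {f : Matrix ι ι ℂ → ℝ} {X : Matrix ι ι ℂ} (hf : DifferentiableAt ℝ f X)
    (V : Matrix ι ι ℂ) : lineDeriv ℝ (fun Y => (f Y : ℂ)) X V = (fderiv ℝ f X V : ℝ) :=
  ((Complex.ofRealCLM.hasFDerivAt.comp X hf.hasFDerivAt).hasLineDerivAt V).lineDeriv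

/-- The inner Wirtinger derivative is `D_X` for `c = -I` and `D_{X*}` for `c = I`, so one
computation serves all four blocks of the Hessian. -/
theorem lineDeriv_wirtinger {f : Matrix ι ι ℂ → ℝ} {A : Matrix ι ι ℂ} (hf : ContDiffAt ℝ 2 f A)
    (c : ℂ) (V P Q : Matrix ι ι ℂ) :
    lineDeriv ℝ (fun Y => (lineDeriv ℝ (fun Z => (f Z : ℂ)) Y P
        + c * lineDeriv ℝ (fun Z => (f Z : ℂ)) Y Q) / 2) A V =
      ((fderiv ℝ (fderiv ℝ f) A V P : ℝ) + c * (fderiv ℝ (fderiv ℝ f) A V Q : ℝ)) / 2 := by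
  have hev : (fun Y => (lineDeriv ℝ (fun Z => (f Z : ℂ)) Y P
        + c * lineDeriv ℝ (fun Z => (f Z : ℂ)) Y Q) / 2) =ᶠ[𝓝 A]
      fun Y => (((fderiv ℝ f Y P : ℝ) : ℂ) + c * (fderiv ℝ f Y Q : ℝ)) / 2 := by
    filter_upwards [hf.eventually (by simp)] with X hX
    have h := hX.differentiableAt (by simp)
    rw [lineDeriv_ofReal h, lineDeriv_ofReal h]
  rw [hev.lineDeriv_eq]
  have hD : HasDerivAt (fun t : ℝ => fderiv ℝ f (A + t • V)) (fderiv ℝ (fderiv ℝ f) A V) 0 :=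
    ((hf.fderiv_right (m := 1) (by norm_num)).differentiableAt
      (by simp)).hasFDerivAt.hasLineDerivAt V
  have hD' : ∀ W, HasDerivAt (fun t : ℝ => ((fderiv ℝ f (A + t • V) W : ℝ) : ℂ))
      (fderiv ℝ (fderiv ℝ f) A V W : ℝ) 0 := fun W => by
    simpa using (hD.clm_apply (hasDerivAt_const 0 W)).ofReal_comp
  exact (((hD' P).add ((hD' Q).const_mul c)).div_const 2).deriv

/-- The commutation matrix pairs `∂/∂X_{ij}` with `∂/∂X_{ji}*`, and their sum is `(∂_S - I ∂_T) / 2`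
with `S` and `T` Hermitian. Applying this in both indices gives the formula. -/
theorem patternedHessian_apply {f : Matrix ι ι ℂ → ℝ} {A : Matrix ι ι ℂ}
    (hf : ContDiffAt ℝ 2 f A) (p q : ι × ι) :
    let S : ι × ι → Matrix ι ι ℂ := fun r => Matrix.single r.2 r.1 1 + Matrix.single r.1 r.2 1
    let T : ι × ι → Matrix ι ι ℂ := fun r =>
      Matrix.single r.2 r.1 Complex.I - Matrix.single r.1 r.2 Complex.I
    let B : Matrix ι ι ℂ → Matrix ι ι ℂ → ℂ := fun H K => (fderiv ℝ (fderiv ℝ f) A H K : ℝ)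
    patternedHessian (fun X => (f X : ℂ)) A p q =
      (B (S p) (S q) - Complex.I * B (S p) (T q) - Complex.I * B (T p) (S q)
        - B (T p) (T q)) / 4 := by
  intro S T B
  have hB : ∀ H K, B H K = B K H := fun H K => by
    simp only [B]
    rw [(hf.isSymmSndFDerivAt (by simp)).eq H K]
  simp only [patternedHessian, Matrix.add_apply, mul_commutationMatrix_apply,
    commutationMatrix_mul_apply, jacX, jacConjX, gradX, gradConjX, Matrix.of_apply,
    sub_eq_add_neg, ← neg_mul, lineDeriv_wirtinger hf, Prod.fst_swap, Prod.snd_swap]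
  rw [hB (S p) (S q), hB (S p) (T q), hB (T p) (S q), hB (T p) (T q)]
  simp only [B, S, T, map_add, map_sub, add_apply, sub_apply, Complex.ofReal_add,
    Complex.ofReal_sub]
  ring_nf
  simp only [Complex.I_sq]
  ring

theorem vec_dotProduct_mulVec_single (M : Matrix (ι × ι) (ι × ι) ℂ) (p q : ι × ι) :
    Matrix.vec (Matrix.single p.2 p.1 1) ⬝ᵥ
      (M *ᵥ Matrix.vec (Matrix.single q.2 q.1 1)) = M p q := by
  simp [Matrix.vec_single]

theorem traceNormHessian_eigendecomposition (hU : U ∈ Matrix.unitaryGroup ι ℂ)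
    (hd : ∀ i, d i ≠ 0) : traceNormHessian (U * realDiag d * Uᴴ) = hessianMatrix U d := by
  ext p q
  rw [traceNormHessian, patternedHessian_apply (contDiffAt_traceNorm hU hd 2)]
  have hS : ∀ r : ι × ι, (Matrix.single r.2 r.1 1 + Matrix.single r.1 r.2 1 :
      Matrix ι ι ℂ).IsHermitian := fun r => by
    simp [Matrix.IsHermitian, Matrix.conjTranspose_add, Matrix.conjTranspose_single, add_comm]
  have hT : ∀ r : ι × ι, (Matrix.single r.2 r.1 Complex.I - Matrix.single r.1 r.2 Complex.I :
      Matrix ι ι ℂ).IsHermitian := fun r => by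
    simp [Matrix.IsHermitian, Matrix.conjTranspose_single,
      Matrix.single_neg, add_comm, sub_eq_add_neg]
  simp only [ofReal_fderiv_fderiv_traceNorm_eq hU hd, hS, hT]
  -- Since `(S - I • T) / 2` is a single matrix unit, complex bilinearity collapses the four terms
  -- to one entry of `hessianMatrix`.
  have hI : ∀ i j : ι, (Matrix.single i j Complex.I : Matrix ι ι ℂ) =
      Complex.I • Matrix.single i j 1 := fun i j => by
    rw [Matrix.smul_single, smul_eq_mul, mul_one]
  simp only [hI, Matrix.vec_add, Matrix.vec_sub, Matrix.vec_smul, Matrix.mulVec_add,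
    Matrix.mulVec_sub, Matrix.mulVec_smul, add_dotProduct, sub_dotProduct, smul_dotProduct,
    dotProduct_add, dotProduct_sub, dotProduct_smul, smul_eq_mul]
  rw [← vec_dotProduct_mulVec_single (hessianMatrix U d) p q]
  ring_nf
  simp only [Complex.I_sq]
  ring

theorem ne_zero_of_isUnit_eigendecomposition (h : IsUnit (U * realDiag d * Uᴴ)) (i : ι) :
    d i ≠ 0 := by
  intro hi
  rw [Matrix.isUnit_iff_isUnit_det, Matrix.det_mul, Matrix.det_mul, realDiag,
    Matrix.det_diagonal, Finset.prod_eq_zero (Finset.mem_univ i) (by simp [hi])] at h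
  simp at h

theorem vec_dotProduct_vec_eq_ofReal_fderiv_traceNorm (hU : U ∈ Matrix.unitaryGroup ι ℂ)
    (hd : ∀ i, d i ≠ 0) {H : Matrix ι ι ℂ} (hH : H.IsHermitian) :
    Matrix.vec (entryConj U * realDiag (fun i => (d i).sign) * Uᵀ) ⬝ᵥ Matrix.vec H =
      (fderiv ℝ traceNorm (U * realDiag d * Uᴴ) H : ℝ) := by
  have h : (entryConj U * realDiag (fun i => (d i).sign) * Uᵀ)ᵀ =
      U * realDiag (fun i => (d i).sign) * Uᴴ := by
    rw [Matrix.transpose_mul, Matrix.transpose_mul, Matrix.transpose_transpose, realDiag,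
      Matrix.diagonal_transpose, Matrix.mul_assoc]
    rfl
  rw [ofReal_fderiv_traceNorm hU hd hH, Matrix.vec_dotProduct_vec, h, Matrix.mul_assoc,
    Matrix.mul_assoc, Matrix.trace_mul_comm, Matrix.mul_assoc, realDiag]
  simp [Matrix.trace, Matrix.diagonal_mul]

theorem isHermitian_of_hasDerivAt {γ : ℝ → Matrix ι ι ℂ} {γ₁ : Matrix ι ι ℂ} {t₀ : ℝ}
    (hγ : ∀ᶠ t in 𝓝 t₀, (γ t).IsHermitian) (h : HasDerivAt γ γ₁ t₀) : γ₁.IsHermitian :=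
  h.star.unique (h.congr_of_eventuallyEq hγ)

/-- Passing to functions of the entries frees the statement from the operator norm; the
identification is linear in finite dimension, hence smooth. -/
theorem contDiffAt_traceNorm_of (hU : U ∈ Matrix.unitaryGroup ι ℂ) (hd : ∀ i, d i ≠ 0) :
    ContDiffAt ℝ 2 (fun x : ι → ι → ℂ => traceNorm (Matrix.of x))
      (fun i j => (U * realDiag d * Uᴴ) i j) := by
  let L : (ι → ι → ℂ) →L[ℝ] Matrix ι ι ℂ :=
    (Matrix.ofLinearEquiv ℝ).toLinearMap.toContinuousLinearMap
  exact ContDiffAt.comp (g := traceNorm) (f := L) _ (contDiffAt_traceNorm hU hd 2)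
    L.contDiff.contDiffAt

/-! ### Partial transpose and negativity along a curve. -/

variable {dA dB : ℕ}

/-- The partial transpose as a continuous real-linear map. -/
noncomputable def partialTransposeCLM (dA dB : ℕ) :
    Matrix (Fin dA × Fin dB) (Fin dA × Fin dB) ℂ →L[ℝ]
      Matrix (Fin dA × Fin dB) (Fin dA × Fin dB) ℂ :=
  LinearMap.toContinuousLinearMap
    { toFun := partialTranspose
      map_add' := fun _ _ => rfl
      map_smul' := fun _ _ => rfl }

theorem hasDerivAt_partialTranspose {ρ : ℝ → Matrix (Fin dA × Fin dB) (Fin dA × Fin dB) ℂ}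
    {ρ₁ : Matrix (Fin dA × Fin dB) (Fin dA × Fin dB) ℂ} {t : ℝ} (h : HasDerivAt ρ ρ₁ t) :
    HasDerivAt (fun t => partialTranspose (ρ t)) (partialTranspose ρ₁) t :=
  (partialTransposeCLM dA dB).hasFDerivAt.comp_hasDerivAt t h

theorem isHermitian_partialTranspose {ρ : Matrix (Fin dA × Fin dB) (Fin dA × Fin dB) ℂ}
    (h : ρ.IsHermitian) : (partialTranspose ρ).IsHermitian := by
  ext ⟨a, i⟩ ⟨b, j⟩
  exact h.apply (a, j) (b, i)

theorem hasDerivAt_negativity {ρ : ℝ → Matrix (Fin dA × Fin dB) (Fin dA × Fin dB) ℂ}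
    {ρ₁ : Matrix (Fin dA × Fin dB) (Fin dA × Fin dB) ℂ} {t : ℝ} (h : HasDerivAt ρ ρ₁ t)
    (hf : DifferentiableAt ℝ traceNorm (partialTranspose (ρ t))) :
    HasDerivAt (fun t => negativity (ρ t))
      (fderiv ℝ traceNorm (partialTranspose (ρ t)) (partialTranspose ρ₁) / 2) t :=
  ((hf.hasFDerivAt.comp_hasDerivAt t (hasDerivAt_partialTranspose h)).sub_const 1).div_const 2

end Negativity

theorem mainTheorem3 {dA dB : ℕ}
    (ρ : ℝ → Matrix (Fin dA × Fin dB) (Fin dA × Fin dB) ℂ) (t₀ : ℝ)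
    (hρ : ∀ᶠ t in 𝓝 t₀, Negativity.IsDensityMatrix (ρ t))
    (hinv : IsUnit (Negativity.partialTranspose (ρ t₀)))
    (U : Matrix (Fin dA × Fin dB) (Fin dA × Fin dB) ℂ)
    (hU : U ∈ Matrix.unitaryGroup (Fin dA × Fin dB) ℂ)
    (Λ : Fin dA × Fin dB → ℝ)
    (hΛ : Negativity.partialTranspose (ρ t₀) = U * Negativity.realDiag Λ * Uᴴ) :
    -- the trace norm is twice continuously (real) differentiable at the partial transpose, as a
    -- function of the matrix entries
    ContDiffAt ℝ 2
      (fun x : Fin dA × Fin dB → Fin dA × Fin dB → ℂ => Negativity.traceNorm (Matrix.of x))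
      (fun i j => Negativity.partialTranspose (ρ t₀) i j) ∧
    -- the patterned Hessian of the trace norm in terms of the eigendecomposition
    Negativity.traceNormHessian (Negativity.partialTranspose (ρ t₀)) =
      Negativity.commutationMatrix (Fin dA × Fin dB) * (Negativity.entryConj U ⊗ₖ U) *
        (1 - Negativity.realDiag (fun i => (Λ i).sign) ⊗ₖ
          Negativity.realDiag (fun i => (Λ i).sign)) *
        (Negativity.kronPlus (Negativity.realDiag fun i => |Λ i|))⁻¹ * (Uᵀ ⊗ₖ Uᴴ) ∧
    -- the first derivative
    (∀ ρ₁ : Matrix (Fin dA × Fin dB) (Fin dA × Fin dB) ℂ, HasDerivAt ρ ρ₁ t₀ →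
      DifferentiableAt ℝ (fun t => Negativity.negativity (ρ t)) t₀ ∧
      ((deriv (fun t => Negativity.negativity (ρ t)) t₀ : ℝ) : ℂ) =
        1 / 2 * (Matrix.vec (Negativity.entryConj U *
            Negativity.realDiag (fun i => (Λ i).sign) * Uᵀ) ⬝ᵥ
          (Negativity.partialCommutationMatrix dA dB *ᵥ Matrix.vec ρ₁))) ∧
    -- the second derivative
    (∀ (ρ' : ℝ → Matrix (Fin dA × Fin dB) (Fin dA × Fin dB) ℂ)
        (ρ₂ : Matrix (Fin dA × Fin dB) (Fin dA × Fin dB) ℂ),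
      (∀ᶠ t in 𝓝 t₀, HasDerivAt ρ (ρ' t) t) → HasDerivAt ρ' ρ₂ t₀ →
      (∀ᶠ t in 𝓝 t₀, DifferentiableAt ℝ (fun t => Negativity.negativity (ρ t)) t) ∧
      DifferentiableAt ℝ (deriv fun t => Negativity.negativity (ρ t)) t₀ ∧
      ((deriv (deriv fun t => Negativity.negativity (ρ t)) t₀ : ℝ) : ℂ) =
        1 / 2 * ((Negativity.partialCommutationMatrix dA dB *ᵥ Matrix.vec (ρ' t₀)) ⬝ᵥ
          (Negativity.traceNormHessian (Negativity.partialTranspose (ρ t₀)) *ᵥ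
            (Negativity.partialCommutationMatrix dA dB *ᵥ Matrix.vec (ρ' t₀)))) +
        1 / 2 * (Matrix.vec (Negativity.entryConj U *
            Negativity.realDiag (fun i => (Λ i).sign) * Uᵀ) ⬝ᵥ
          (Negativity.partialCommutationMatrix dA dB *ᵥ Matrix.vec ρ₂))) := by
  have hd : ∀ i, Λ i ≠ 0 := fun i =>
    Negativity.ne_zero_of_isUnit_eigendecomposition (hΛ ▸ hinv) i
  have hherm : ∀ᶠ t in 𝓝 t₀, (Negativity.partialTranspose (ρ t)).IsHermitian :=
    hρ.mono fun t ht => Negativity.isHermitian_partialTranspose ht.1.isHermitian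
  open scoped Matrix.Norms.L2Operator in
  have hC : ContDiffAt ℝ 2 Negativity.traceNorm (Negativity.partialTranspose (ρ t₀)) :=
    hΛ ▸ Negativity.contDiffAt_traceNorm hU hd 2
  refine ⟨?_, ?_, ?_, ?_⟩
  · rw [hΛ]; exact Negativity.contDiffAt_traceNorm_of hU hd
  · rw [hΛ]; exact Negativity.traceNormHessian_eigendecomposition hU hd
  · intro ρ₁ h₁
    have h := Negativity.hasDerivAt_negativity h₁ (hC.differentiableAt (by simp))
    have hH := Negativity.isHermitian_of_hasDerivAt hherm
      (Negativity.hasDerivAt_partialTranspose h₁)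
    refine ⟨h.differentiableAt, ?_⟩
    rw [h.deriv, Negativity.partialCommutationMatrix_mulVec_vec,
      Negativity.vec_dotProduct_vec_eq_ofReal_fderiv_traceNorm hU hd hH, hΛ]
    push_cast
    ring
  · intro ρ' ρ₂ h₁ h₂
    have hpt := h₁.mono fun t ht => Negativity.hasDerivAt_partialTranspose ht
    have hpt₂ := Negativity.hasDerivAt_partialTranspose h₂
    -- The derivative formulas hold only in Hermitian directions. Hermiticity of the first
    -- derivative near `t₀` passes to the second derivative at `t₀`.
    have hherm' : ∀ᶠ t in 𝓝 t₀, (Negativity.partialTranspose (ρ' t)).IsHermitian := by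
      filter_upwards [hherm.eventually_nhds, hpt] with t ht ht'
      exact Negativity.isHermitian_of_hasDerivAt ht ht'
    have hH₂ := Negativity.isHermitian_of_hasDerivAt hherm' hpt₂
    have hH₁ := hherm'.self_of_nhds
    have hdiff := hpt.self_of_nhds.continuousAt.eventually (hC.eventually (by simp))
    open scoped Matrix.Norms.L2Operator in
    have hN : ∀ᶠ t in 𝓝 t₀, HasDerivAt (fun t => Negativity.negativity (ρ t))
        (fderiv ℝ Negativity.traceNorm (Negativity.partialTranspose (ρ t))
          (Negativity.partialTranspose (ρ' t)) / 2) t := by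
      filter_upwards [hdiff, h₁] with t ht ht'
      exact Negativity.hasDerivAt_negativity ht' (ht.differentiableAt (by simp))
    have hN₂ := (Negativity.hasDerivAt_fderiv_comp hC hpt.self_of_nhds hpt₂).div_const 2
    -- Near `t₀` the derivative of the negativity equals the chain-rule expression, so the latter
    -- may be differentiated in its place.
    have hN' := hN₂.congr_of_eventuallyEq (hN.mono fun t ht => ht.deriv)
    refine ⟨hN.mono fun t ht => ht.differentiableAt, hN'.differentiableAt, ?_⟩
    rw [hN'.deriv, Negativity.partialCommutationMatrix_mulVec_vec,
      Negativity.partialCommutationMatrix_mulVec_vec,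
      Negativity.vec_dotProduct_vec_eq_ofReal_fderiv_traceNorm hU hd hH₂, hΛ,
      Negativity.traceNormHessian_eigendecomposition hU hd,
      ← Negativity.ofReal_fderiv_fderiv_traceNorm_eq hU hd hH₁ hH₁]
    push_cast
    ring
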